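/- For integers $0\le k\le n$ and $\sigma\in S_k$, let $$\mathrm{Wg}_{k,n}(\sigma)=\mathbb{E}\left[u_{11}u_{22}\cdots u_{kk}\,\overline{u_{1\sigma(1)}u_{2\sigma(2)}\cdots u_{k\sigma(k)}}\right]$$ be the unitary Weingarten function, where $U=(u_{ij})_{1\le i,j\le n}$ is a Haar-distributed random matrix in the unitary group $\mathrm{U}(n)$ (for $k=0$ the empty product is $1$, so $\mathrm{Wg}_{0,0}=1$ on the trivial group $S_0$). Write $n^{\uparrow m}=n(n+1)\cdots(n+m-1)$, with $n^{\uparrow 0}=1$. Then, for every integer $n\ge 1$ and every $\pi\in S_n$, $$\mathrm{Wg}_{n,n}(\pi)=\sum_{\tau\in S_{n-1}}a_n(\pi,\tau)\,\mathrm{Wg}_{n-1,n-1}(\tau),$$ where, for $\pi\in S_n$ and $\tau\in S_{n-1}$, $$a_n(\pi,\tau)=\sum_{t=0}^{\mathrm{fix}(\pi,\tau)}(-1)^{n-t+1}\binom{\mathrm{fix}(\pi,\tau)}{t}\frac{1}{n^{\uparrow(n-t)}},\qquad \mathrm{fix}(\pi,\tau)=\bigl|\{i\in\{1,2,\dots,n-1\}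 : \pi(\tau(i))=i\}\bigr|.$$ -/

import Mathlib

open Matrix MeasureTheory

/-- `U(n)`, the group of unitary `n × n` complex matrices. -/
abbrev UGroup (n : ℕ) : Type := Matrix.unitaryGroup (Fin n) ℂ

/-- The Borel σ-algebra of `U(n)`, for its topology as a set of matrices. -/
noncomputable instance UGroup.instMeasurableSpace (n : ℕ) : MeasurableSpace (UGroup n) :=
  borel (UGroup n)

instance UGroup.instBorelSpace (n : ℕ) : BorelSpace (UGroup n) :=
  ⟨rfl⟩

instance UGroup.instCompactSpace (n : ℕ) : CompactSpace (UGroup n) := by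
  have hK : IsCompact
      (Set.univ.pi fun _ : Fin n => Set.univ.pi fun _ : Fin n => Metric.closedBall (0 : ℂ) 1) :=
    isCompact_univ_pi fun _ => isCompact_univ_pi fun _ => isCompact_closedBall 0 1
  have hU : IsClosed ((Matrix.unitaryGroup (Fin n) ℂ : Set (Matrix (Fin n) (Fin n) ℂ))) :=
    isClosed_unitary
  refine isCompact_iff_compactSpace.mp (hK.of_isClosed_subset hU ?_)
  intro A hA i _ j _
  simpa using entry_norm_bound_of_unitary hA i j

/-- The Haar probability measure of the compact group `U(n)`: the Haar measure that gives the
whole group mass one. -/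
noncomputable def haarU (n : ℕ) : Measure (UGroup n) :=
  Measure.haarMeasure (⊤ : TopologicalSpace.PositiveCompacts (UGroup n))

instance haarU.instIsProbabilityMeasure (n : ℕ) : IsProbabilityMeasure (haarU n) :=
  ⟨Measure.haarMeasure_self (K₀ := (⊤ : TopologicalSpace.PositiveCompacts (UGroup n)))⟩

/-- The unitary Weingarten function `Wg_{k,n}` on `S_k`, for `k ≤ n`: the expectation of
`u₁₁ ⋯ uₖₖ` times the complex conjugate of `u_{1π(1)} ⋯ u_{kπ(k)}`, for a Haar-distributed
`U = (u_{ij})` in `U(n)`. -/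
noncomputable def Wg (k n : ℕ) (hk : k ≤ n) (π : Equiv.Perm (Fin k)) : ℂ :=
  ∫ U : UGroup n,
    (∏ i : Fin k, U.1 (Fin.castLE hk i) (Fin.castLE hk i)) *
      star (∏ i : Fin k, U.1 (Fin.castLE hk i) (Fin.castLE hk (π i))) ∂(haarU n)

/-- For `π ∈ S_{m+1}` and `τ ∈ S_m`, the number of `i ∈ {1, …, m}` with `π(τ(i)) = i`, where
`{1, …, m}` is regarded as a subset of `{1, …, m+1}`. -/
def fixCount {m : ℕ} (π : Equiv.Perm (Fin (m + 1))) (τ : Equiv.Perm (Fin m)) : ℕ :=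
  (Finset.univ.filter fun i : Fin m => π (τ i).castSucc = i.castSucc).card

/-- The coefficient `a_n(π, τ)` for `π ∈ S_n`, `τ ∈ S_{n-1}`, where `n = m + 1`. The rising
factorial `n^{↑(n-t)} = n (n+1) ⋯ (2n-t-1)` is `Nat.ascFactorial n (n - t)`. All `t` in the sum
satisfy `t ≤ m < n`, so that the subtractions do not truncate. -/
noncomputable def aCoeff (m : ℕ) (π : Equiv.Perm (Fin (m + 1))) (τ : Equiv.Perm (Fin m)) : ℂ :=
  ∑ t ∈ Finset.range (fixCount π τ + 1),
    (-1 : ℂ) ^ (m + 1 - t + 1) * ((fixCount π τ).choose t : ℂ) *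
      (1 / ((Nat.ascFactorial (m + 1) (m + 1 - t) : ℕ) : ℂ))

/-! By invariance `U` may be replaced by `blockU V * U` with `V` an independent Haar element of
U(m), n = m + 1; the last row of `U` is untouched. For fixed `U` the average over `V` is, up to two
last-row entries, `diagPairing A B` with `A`, `B` cut from the first m rows. This depends only on
`Aᴴ * B`: unitary factors move across by invariance, arbitrary ones by the unitarian trick
(`diagPairing_mul_left`). Moving `A` itself across leaves a sum over S_m weighted by Wg
(`diagPairing_eq_sum_Wg`). Since the columns of `U` are orthonormal, each entry of `Aᴴ * B` is a
Kronecker delta minus a product of last-row entries. Choosing the delta on a set T, necessarily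
inside the set counted by `fixCount`, leaves the moment of n - |T| distinct squared moduli of one
row, which is 1/n^{↑(n-|T|)} (`integral_prod_entrySq`). Grouping by t = |T| gives `aCoeff`. -/

/-! ### Haar invariance and symmetries of Wg -/

instance haarU.instIsHaarMeasure (n : ℕ) : (haarU n).IsHaarMeasure := by
  unfold haarU; infer_instance

/-- The Haar probability measure of `U(n)` is invariant under right translations. -/
instance haarU.instIsMulRightInvariant (n : ℕ) : (haarU n).IsMulRightInvariant := by
  refine ⟨fun g => ?_⟩
  have : IsProbabilityMeasure (Measure.map (· * g) (haarU n)) :=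
    Measure.isProbabilityMeasure_map (continuous_mul_const g).measurable.aemeasurable
  exact Measure.isHaarMeasure_eq_of_isProbabilityMeasure _ _

theorem continuous_entry {n : ℕ} (i j : Fin n) : Continuous fun U : UGroup n => U.1 i j :=
  continuous_subtype_val.matrix_elem i j

theorem integrable_haarU {n : ℕ} {f : UGroup n → ℂ} (hf : Continuous f) :
    Integrable f (haarU n) :=
  hf.integrable_of_hasCompactSupport (HasCompactSupport.of_compactSpace f)

theorem integral_haarU_mul_left {n : ℕ} (f : UGroup n → ℂ) (g : UGroup n) :
    ∫ U, f (g * U) ∂(haarU n) = ∫ U, f U ∂(haarU n) :=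
  integral_mul_left_eq_self f g

theorem integral_haarU_mul_right {n : ℕ} (f : UGroup n → ℂ) (g : UGroup n) :
    ∫ U, f (U * g) ∂(haarU n) = ∫ U, f U ∂(haarU n) :=
  integral_mul_right_eq_self f g

/-- The diagonal unitary matrix with the given unimodular entries. -/
def diagU {n : ℕ} (d : Fin n → ℂ) (hd : ∀ i, d i * star (d i) = 1) : UGroup n :=
  ⟨diagonal d, by
    rw [mem_unitaryGroup_iff, star_eq_conjTranspose, diagonal_conjTranspose, diagonal_mul_diagonal,
      ← diagonal_one]
    exact congrArg diagonal (funext hd)⟩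

/-- The permutation matrix of `σ`, as a unitary matrix. -/
def permU {n : ℕ} (σ : Equiv.Perm (Fin n)) : UGroup n :=
  ⟨σ.permMatrix ℂ, by
    rw [mem_unitaryGroup_iff, star_eq_conjTranspose, conjTranspose_permMatrix,
      ← permMatrix_mul]
    simp⟩

theorem mul_permU {n : ℕ} (U : UGroup n) (σ : Equiv.Perm (Fin n)) (i j : Fin n) :
    (U * permU σ).1 i j = U.1 i (σ.symm j) := by
  have h (x : Fin n) : j = σ x ↔ x = σ.symm j := by rw [Equiv.eq_symm_apply, eq_comm]
  simp [permU, Matrix.mul_apply, Equiv.Perm.permMatrix, PEquiv.toMatrix_apply, h, eq_comm]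

theorem permU_mul {n : ℕ} (U : UGroup n) (σ : Equiv.Perm (Fin n)) (i j : Fin n) :
    (permU σ * U).1 i j = U.1 (σ i) j := by
  simp [permU, Matrix.mul_apply, Equiv.Perm.permMatrix, PEquiv.toMatrix_apply]

theorem mul_diagU {n : ℕ} (U : UGroup n) (d : Fin n → ℂ) (hd) (i j : Fin n) :
    (U * diagU d hd).1 i j = U.1 i j * d j := by
  simp [diagU]

/-- The Weingarten function is a class function. -/
theorem Wg_conj {n : ℕ} (σ τ : Equiv.Perm (Fin n)) :
    Wg n n le_rfl (σ * τ * σ⁻¹) = Wg n n le_rfl τ := by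
  unfold Wg
  rw [← integral_haarU_mul_left _ (permU σ⁻¹), ← integral_haarU_mul_right _ (permU σ)]
  congr 1 with U
  have h (i j : Fin n) : (permU σ⁻¹ * (U * permU σ)).1 i j = U.1 (σ⁻¹ i) (σ⁻¹ j) := by
    rw [permU_mul, mul_permU]; rfl
  simp only [Fin.castLE_rfl, id, h, Equiv.Perm.mul_apply, ← Equiv.Perm.mul_apply σ⁻¹ σ,
    inv_mul_cancel, Equiv.Perm.one_apply]
  rw [Equiv.prod_comp σ⁻¹ fun i => U.1 i i, Equiv.prod_comp σ⁻¹ fun i => U.1 i (τ i)]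

/-- A permutation and its inverse have the same cycle type, hence are conjugate. -/
theorem Wg_inv {n : ℕ} (τ : Equiv.Perm (Fin n)) : Wg n n le_rfl τ⁻¹ = Wg n n le_rfl τ := by
  obtain ⟨σ, hσ⟩ := isConj_iff.1 (Equiv.Perm.isConj_iff_cycleType_eq.2 (Equiv.Perm.cycleType_inv τ))
  rw [← Wg_conj σ τ⁻¹, hσ]

/-! ### Averaging over the block subgroup U(m) -/

/-- The block diagonal embedding of `U(m)` in `U(m + 1)`. -/
def blockU {m : ℕ} (V : UGroup m) : UGroup (m + 1) :=
  ⟨Matrix.of fun i j => Fin.lastCases (motive := fun _ => ℂ)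
      (Fin.lastCases (motive := fun _ => ℂ) 1 (fun _ => 0) j)
      (fun i' => Fin.lastCases (motive := fun _ => ℂ) 0 (fun j' => V.1 i' j') j) i, by
    have hV := mem_unitaryGroup_iff.1 V.2
    rw [mem_unitaryGroup_iff]
    ext i j
    refine Fin.lastCases ?_ (fun i => ?_) i <;> refine Fin.lastCases ?_ (fun j => ?_) j
    · simp [Matrix.mul_apply, Fin.sum_univ_castSucc]
    · simp [Matrix.mul_apply, Fin.sum_univ_castSucc, (Fin.castSucc_ne_last j).symm]
    · simp [Matrix.mul_apply, Fin.sum_univ_castSucc]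
    · have := congrFun (congrFun hV i) j
      simpa [Matrix.mul_apply, Fin.sum_univ_castSucc, Matrix.one_apply] using this⟩

theorem blockU_mul_castSucc {m : ℕ} (V : UGroup m) (U : UGroup (m + 1)) (i : Fin m)
    (j : Fin (m + 1)) :
    (blockU V * U).1 i.castSucc j = ∑ k : Fin m, V.1 i k * U.1 k.castSucc j := by
  simp [blockU, Matrix.mul_apply, Fin.sum_univ_castSucc]

theorem blockU_mul_last {m : ℕ} (V : UGroup m) (U : UGroup (m + 1)) (j : Fin (m + 1)) :
    (blockU V * U).1 (Fin.last m) j = U.1 (Fin.last m) j := by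
  simp [blockU, Matrix.mul_apply, Fin.sum_univ_castSucc]

theorem continuous_blockU {m : ℕ} : Continuous (blockU (m := m)) := by
  refine Continuous.subtype_mk (continuous_matrix fun i j => ?_) _
  refine Fin.lastCases ?_ (fun i => ?_) i <;> refine Fin.lastCases ?_ (fun j => ?_) j
  · simpa using continuous_const
  · simpa using continuous_const
  · simpa using continuous_const
  · simpa using continuous_entry i j

/-- Averaging over `U(m + 1)` may be preceded by averaging over the left translates by the
block diagonal copy of `U(m)`. -/
theorem integral_haarU_succ {m : ℕ} {f : UGroup (m + 1) → ℂ} (hf : Continuous f) :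
    ∫ U, f U ∂(haarU (m + 1)) =
      ∫ U, ∫ V, f (blockU V * U) ∂(haarU m) ∂(haarU (m + 1)) := by
  -- With `V` fixed, left invariance makes the integral over `U` independent of `V`.
  rw [integral_integral_swap_of_hasCompactSupport]
  · simp_rw [integral_haarU_mul_left]
    simp
  · exact hf.comp ((continuous_blockU.comp continuous_snd).mul continuous_fst)
  · exact HasCompactSupport.of_compactSpace _

/-! ### The unitarian trick -/

/-- An entire function vanishing on the unit circle vanishes identically. -/
theorem Differentiable.eq_zero_of_sphere {f : ℂ → ℂ} (hf : Differentiable ℂ f)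
    (h : ∀ z : ℂ, ‖z‖ = 1 → f z = 0) (z : ℂ) : f z = 0 := by
  have hb : Set.EqOn f 0 (Metric.ball 0 1) := by
    refine Complex.eqOn_of_eqOn_frontier Metric.isBounded_ball hf.diffContOnCl
      (differentiable_const _).diffContOnCl fun z hz => ?_
    rw [frontier_ball _ one_ne_zero] at hz
    exact h z (by simpa using hz)
  have hA : AnalyticOnNhd ℂ f Set.univ := fun z _ => hf.analyticAt z
  have := hA.eq_of_eventuallyEq (g := 0) (z₀ := 0) (fun z _ => analyticAt_const)
    (hb.eventuallyEq_of_mem (Metric.ball_mem_nhds _ one_pos))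
  exact congrFun this z

/-- An entire function vanishing on the real line vanishes identically. -/
theorem Differentiable.eq_zero_of_real {f : ℂ → ℂ} (hf : Differentiable ℂ f)
    (h : ∀ x : ℝ, f x = 0) (z : ℂ) : f z = 0 := by
  have hA : AnalyticOnNhd ℂ f Set.univ := fun z _ => hf.analyticAt z
  have := hA.eq_of_frequently_eq (g := 0) (z₀ := 0) (fun z _ => analyticAt_const) (by
    have ht : Filter.Tendsto (fun x : ℝ => (x : ℂ)) (nhdsWithin 0 {0}ᶜ) (nhdsWithin 0 {0}ᶜ) := by
      refine tendsto_nhdsWithin_iff.2 ⟨?_, ?_⟩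
      · exact (Complex.continuous_ofReal.tendsto' 0 0 (by simp)).mono_left nhdsWithin_le_nhds
      · filter_upwards [self_mem_nhdsWithin] with x hx
        simpa using hx
    exact ht.frequently (Filter.Eventually.frequently (Filter.Eventually.of_forall h)))
  exact congrFun this z

/-- A function of a matrix which is holomorphic along every complex line and vanishes on the
unitary group vanishes identically. -/
theorem eq_zero_of_unitary {n : ℕ} {P : Matrix (Fin n) (Fin n) ℂ → ℂ}
    (hP : ∀ A B, Differentiable ℂ fun z : ℂ => P (A + z • B))
    (h : ∀ U : UGroup n, P U.1 = 0) (G : Matrix (Fin n) (Fin n) ℂ) : P G = 0 := by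
  -- The diagonal entries are released from the unit circle one at a time.
  have hdiag (U V : UGroup n) (s : Finset (Fin n)) : ∀ d : Fin n → ℂ,
      (∀ i ∉ s, ‖d i‖ = 1) → P (U.1 * diagonal d * V.1) = 0 := by
    induction s using Finset.induction_on with
    | empty =>
      intro d hd
      refine h (U * diagU d (fun i => ?_) * V)
      rw [← starRingEnd_apply, Complex.mul_conj']
      simp [hd i]
    | insert i s hi ih =>
      intro d hd
      have key := Differentiable.eq_zero_of_sphere
        (hP (U.1 * diagonal (Function.update d i 0) * V.1)
          (U.1 * diagonal (Pi.single i 1) * V.1)) (fun z hz => ?_) (d i)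
      · rw [← key]
        congr 1
        rw [← smul_mul_assoc, ← mul_smul_comm, ← add_mul, ← mul_add, ← diagonal_smul,
          diagonal_add]
        congr 3
        funext j
        by_cases hj : j = i
        · subst hj; simp
        · simp [hj]
      · refine (congrArg P ?_).trans (ih (Function.update d i z) ?_)
        · rw [← smul_mul_assoc, ← mul_smul_comm, ← add_mul, ← mul_add, ← diagonal_smul,
            diagonal_add]
          congr 3
          funext j
          by_cases hj : j = i
          · subst hj; simp
          · simp [hj]
        · intro j hj
          by_cases hji : j = i
          · subst hji; simpa using hz
          · simpa [hji] using hd j (by simp [hji, hj])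
  have hherm (H : Matrix (Fin n) (Fin n) ℂ) (hH : H.IsHermitian) : P H = 0 := by
    rw [hH.spectral_theorem, Unitary.conjStarAlgAut_apply]
    exact hdiag _ (star hH.eigenvectorUnitary) Finset.univ _ (by simp)
  have hre : (star G + G).IsHermitian := by
    rw [IsHermitian, ← star_eq_conjTranspose]; simp [add_comm]
  have him : (Complex.I • (star G - G)).IsHermitian := by
    rw [IsHermitian, ← star_eq_conjTranspose, star_smul]; simp [add_comm, sub_eq_add_neg]
  -- G = H + iK with H, K Hermitian; H + xK is Hermitian for real x, and x = i gives G.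
  have key := (hP ((2⁻¹ : ℝ) • (star G + G)) ((2⁻¹ : ℝ) • (Complex.I • (star G - G)))).eq_zero_of_real
    (fun x => hherm _ ?_) Complex.I
  · rw [← key]
    congr 1
    ext i j
    simp only [Matrix.add_apply, Matrix.smul_apply, Matrix.sub_apply, smul_eq_mul,
      Complex.real_smul]
    push_cast
    linear_combination (-(1 / 2) * ((star G) i j - G i j)) * Complex.I_mul_I
  · have hr (x : ℝ) {H : Matrix (Fin n) (Fin n) ℂ} (hH : H.IsHermitian) : (x • H).IsHermitian := by
      rw [IsHermitian, conjTranspose_smul, hH.eq]; simp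
    have := (hr 2⁻¹ hre).add (hr x (hr 2⁻¹ him))
    simpa using this

/-! ### The Weingarten formula -/

/-- The averaged product of diagonal entries of `U A` and conjugated diagonal entries of `U B`. -/
noncomputable def diagPairing {n : ℕ} (A B : Matrix (Fin n) (Fin n) ℂ) : ℂ :=
  ∫ U : UGroup n, (∏ a, (U.1 * A) a a) * star (∏ a, (U.1 * B) a a) ∂(haarU n)

/-- The averaged product of the entries of `U` at `(a, f a)` and the conjugated ones at
`(a, g a)`. -/
noncomputable def entryMoment {n : ℕ} (f g : Fin n → Fin n) : ℂ :=
  ∫ U : UGroup n, (∏ a, U.1 a (f a)) * star (∏ a, U.1 a (g a)) ∂(haarU n)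

theorem diagPairing_eq_sum {n : ℕ} (A B : Matrix (Fin n) (Fin n) ℂ) :
    diagPairing A B = ∑ f : Fin n → Fin n, ∑ g : Fin n → Fin n,
      (∏ a, A (f a) a) * star (∏ a, B (g a) a) * entryMoment f g := by
  have hc (f : Fin n → Fin n) : Continuous fun U : UGroup n => ∏ a, U.1 a (f a) :=
    continuous_finsetProd _ fun a _ => continuous_entry _ _
  have hexp (A : Matrix (Fin n) (Fin n) ℂ) (U : UGroup n) : ∏ a, (U.1 * A) a a =
      ∑ f : Fin n → Fin n, (∏ a, A (f a) a) * ∏ a, U.1 a (f a) := by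
    simp only [Matrix.mul_apply]
    rw [Finset.prod_univ_sum, Fintype.piFinset_univ]
    simp only [Finset.prod_mul_distrib, mul_comm]
  have hint (f g : Fin n → Fin n) : Integrable (fun U : UGroup n =>
      (∏ a, A (f a) a) * star (∏ a, B (g a) a) *
        ((∏ a, U.1 a (f a)) * star (∏ a, U.1 a (g a)))) (haarU n) :=
    integrable_haarU (continuous_const.mul ((hc f).mul (hc g).star))
  unfold diagPairing entryMoment
  simp only [← integral_const_mul]
  simp only [← integral_finsetSum _ fun g _ => hint _ g]
  rw [← integral_finsetSum _ fun f _ => integrable_finsetSum _ fun g _ => hint f g]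
  congr 1 with U
  rw [hexp, hexp, star_sum, Finset.sum_mul_sum]
  refine Finset.sum_congr rfl fun f _ => Finset.sum_congr rfl fun g _ => ?_
  rw [star_mul']
  ring

theorem diagPairing_unitary_mul {n : ℕ} (U : UGroup n) (A B : Matrix (Fin n) (Fin n) ℂ) :
    diagPairing (U.1 * A) B = diagPairing A (U.1ᴴ * B) := by
  unfold diagPairing
  rw [← integral_haarU_mul_right (fun V : UGroup n => _ * star (∏ a, (V.1 * (U.1ᴴ * B)) a a)) U]
  congr 1 with V
  have : (V * U).1 * (U.1ᴴ * B) = V.1 * B := by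
    have hU : U.1 * U.1ᴴ = 1 := mem_unitaryGroup_iff.1 U.2
    calc (V * U).1 * (U.1ᴴ * B) = V.1 * (U.1 * U.1ᴴ) * B := by simp [mul_assoc]
      _ = _ := by simp [hU]
  rw [this]
  simp [mul_assoc]

/-- Both sides are polynomial in the entries of `G`, since the conjugation on the second factor
undoes that in `Gᴴ`; agreement on U(n) therefore suffices. -/
theorem diagPairing_mul_left {n : ℕ} (G A B : Matrix (Fin n) (Fin n) ℂ) :
    diagPairing (G * A) B = diagPairing A (Gᴴ * B) := by
  rw [← sub_eq_zero]
  refine eq_zero_of_unitary (P := fun G => diagPairing (G * A) B - diagPairing A (Gᴴ * B))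
    (fun C D => ?_) (fun U => sub_eq_zero.2 (diagPairing_unitary_mul U A B)) G
  simp only [diagPairing_eq_sum, Matrix.mul_apply, Matrix.add_apply, Matrix.smul_apply,
    conjTranspose_apply, star_prod, star_sum, star_mul', star_star, smul_eq_mul]
  fun_prop

/-- Negating a column missed by `f` changes the sign of the integrand. -/
theorem entryMoment_eq_zero {n : ℕ} {f : Fin n → Fin n} (hf : ¬ Function.Surjective f) :
    entryMoment id f = 0 := by
  obtain ⟨c, hc⟩ := not_forall.1 hf
  have hc' : ∀ a, f a ≠ c := fun a h => hc ⟨a, h⟩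
  have key : entryMoment id f = -entryMoment id f := by
    nth_rw 1 [entryMoment]
    rw [← integral_haarU_mul_right _ (diagU (Function.update 1 c (-1)) fun i => ?_)]
    · rw [entryMoment, ← integral_neg]
      congr 1 with U
      simp only [mul_diagU, Finset.prod_mul_distrib, id]
      rw [Finset.prod_update_of_mem (Finset.mem_univ c)]
      simp [Function.update_of_ne (hc' _)]
    · by_cases h : i = c
      · subst h; simp
      · simp [h]
  exact self_eq_neg.1 key

/-- The Weingarten formula, in terms of `diagPairing`. -/
theorem diagPairing_eq_sum_Wg {n : ℕ} (A B : Matrix (Fin n) (Fin n) ℂ) :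
    diagPairing A B =
      ∑ β : Equiv.Perm (Fin n), star (∏ a, (Aᴴ * B) (β a) a) * Wg n n le_rfl β := by
  -- With the identity in the first slot only `f = id` survives, and then only bijective `g`.
  rw [← mul_one A, diagPairing_mul_left, mul_one, diagPairing_eq_sum, Finset.sum_eq_single id]
  · have h1 : ∏ a : Fin n, (1 : Matrix (Fin n) (Fin n) ℂ) (id a) a = 1 :=
      Finset.prod_eq_one fun a _ => one_apply_eq a
    simp only [h1, one_mul]
    symm
    refine Finset.sum_bij_ne_zero (fun β _ _ => (β : Fin n → Fin n)) (by simp) ?_ ?_ ?_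
    · intro β _ _ γ _ _ h
      exact DFunLike.coe_injective h
    · intro f _ hf
      have hs : Function.Surjective f := by
        by_contra h
        exact hf (by rw [entryMoment_eq_zero h, mul_zero])
      exact ⟨Equiv.ofBijective f (Finite.surjective_iff_bijective.1 hs), by simp, hf, rfl⟩
    · intro β _ _
      rfl
  · intro f _ hf
    obtain ⟨a, ha⟩ := Function.ne_iff.1 hf
    refine Finset.sum_eq_zero fun g _ => ?_
    have h0 : ∏ a : Fin n, (1 : Matrix (Fin n) (Fin n) ℂ) (f a) a = 0 :=
      Finset.prod_eq_zero (Finset.mem_univ a) (one_apply_ne ha)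
    rw [h0, zero_mul, zero_mul]
  · simp

/-! ### Moments of squared moduli in one row -/

/-- The squared modulus of an entry of a unitary matrix, as a complex number. -/
noncomputable def entrySq {n : ℕ} (U : UGroup n) (r i : Fin n) : ℂ :=
  U.1 r i * star (U.1 r i)

theorem continuous_entrySq {n : ℕ} (r i : Fin n) :
    Continuous fun U : UGroup n => entrySq U r i :=
  (continuous_entry r i).mul (continuous_entry r i).star

theorem continuous_prod_entrySq {n : ℕ} (r : Fin n) (S : Finset (Fin n)) :
    Continuous fun U : UGroup n => ∏ i ∈ S, entrySq U r i :=
  continuous_finsetProd _ fun _ _ => continuous_entrySq _ _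

theorem sum_entrySq {n : ℕ} (U : UGroup n) (r : Fin n) : ∑ i, entrySq U r i = 1 := by
  have hU : U.1 * U.1ᴴ = 1 := mem_unitaryGroup_iff.1 U.2
  simpa [Matrix.mul_apply, entrySq] using congrFun (congrFun hU r) r

theorem entrySq_mul_permU {n : ℕ} (U : UGroup n) (σ : Equiv.Perm (Fin n)) (r i : Fin n) :
    entrySq (U * permU σ) r i = entrySq U r (σ.symm i) := by
  simp only [entrySq, mul_permU]

theorem entrySq_mul_diagU {n : ℕ} (U : UGroup n) (d : Fin n → ℂ) (hd) (r i : Fin n) :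
    entrySq (U * diagU d hd) r i = entrySq U r i := by
  simp only [entrySq, mul_diagU, star_mul']
  linear_combination (U.1 r i * star (U.1 r i)) * hd i

theorem prod_entrySq_mul_swap {n : ℕ} {i j : Fin n} (U : UGroup n) (r : Fin n)
    {S : Finset (Fin n)} (hi : i ∉ S) (hj : j ∉ S) :
    ∏ k ∈ S, entrySq (U * permU (Equiv.swap i j)) r k = ∏ k ∈ S, entrySq U r k := by
  refine Finset.prod_congr rfl fun k hk => ?_
  rw [entrySq_mul_permU, Equiv.symm_swap, Equiv.swap_apply_of_ne_of_ne] <;>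
    rintro rfl <;> contradiction

theorem integral_prod_insert_entrySq_eq {n : ℕ} {i j : Fin n} (r : Fin n)
    {S : Finset (Fin n)} (hi : i ∉ S) (hj : j ∉ S) :
    ∫ U, ∏ k ∈ insert i S, entrySq U r k ∂(haarU n) =
      ∫ U, ∏ k ∈ insert j S, entrySq U r k ∂(haarU n) := by
  rw [← integral_haarU_mul_right _ (permU (Equiv.swap i j))]
  congr 1 with U
  rw [Finset.prod_insert hi, Finset.prod_insert hj, prod_entrySq_mul_swap U r hi hj,
    entrySq_mul_permU]
  simp

theorem integral_entrySq_sq_mul_eq {n : ℕ} {i j : Fin n} (r : Fin n)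
    {S : Finset (Fin n)} (hi : i ∉ S) (hj : j ∉ S) :
    ∫ U, entrySq U r i ^ 2 * ∏ k ∈ S, entrySq U r k ∂(haarU n) =
      ∫ U, entrySq U r j ^ 2 * ∏ k ∈ S, entrySq U r k ∂(haarU n) := by
  rw [← integral_haarU_mul_right _ (permU (Equiv.swap i j))]
  congr 1 with U
  rw [prod_entrySq_mul_swap U r hi hj, entrySq_mul_permU]
  simp

/-- Multiplying column `i` by the imaginary unit negates the integrand. -/
theorem integral_cross_entry_eq_zero {n : ℕ} {i j : Fin n} (hij : i ≠ j) (r : Fin n)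
    (S : Finset (Fin n)) :
    ∫ U : UGroup n, U.1 r i ^ 2 * star (U.1 r j) ^ 2 * ∏ k ∈ S, entrySq U r k ∂(haarU n) = 0 := by
  refine self_eq_neg.1 ?_
  nth_rw 1 [← integral_haarU_mul_right _ (diagU (Function.update 1 i Complex.I) fun k => ?_)]
  · rw [← integral_neg]
    congr 1 with U
    simp only [entrySq_mul_diagU]
    rw [mul_diagU, mul_diagU, Function.update_self, Function.update_of_ne hij.symm, mul_pow,
      Complex.I_sq]
    simp
  · by_cases h : k = i
    · subst h; simp
    · simp [h]

/-- The unitary involution acting as a Hadamard matrix on the coordinates `i` and `j`. -/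
noncomputable def hadamardU {n : ℕ} (i j : Fin n) (hij : i ≠ j) : UGroup n :=
  ⟨1 - (single i i 1 + single j j 1) + (((√2)⁻¹ : ℝ) : ℂ) •
      (single i i 1 + single i j 1 + single j i 1 - single j j 1), by
    have hc : (((√2)⁻¹ : ℝ) : ℂ) * (((√2)⁻¹ : ℝ) : ℂ) = 2⁻¹ := by
      rw [← Complex.ofReal_mul, ← mul_inv, Real.mul_self_sqrt zero_le_two]; simp
    rw [mem_unitaryGroup_iff]
    generalize ((√2)⁻¹ : ℝ) = c at hc
    set P : Matrix (Fin n) (Fin n) ℂ := single i i 1 + single j j 1 with hP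
    set K : Matrix (Fin n) (Fin n) ℂ :=
      single i i 1 + single i j 1 + single j i 1 - single j j 1 with hK
    -- `P` projects onto the two coordinates and `K` is √2 times the Hadamard block there, so K² =
    -- 2P.
    have hPP : P * P = P := by
      simp [hP, mul_add, add_mul, hij, hij.symm]
    have hPK : P * K = K := by
      simp [hP, hK, mul_add, add_mul, mul_sub, hij, hij.symm]
    have hKP : K * P = K := by
      simp [hP, hK, mul_add, add_mul, sub_mul, hij, hij.symm]
      abel
    have hKK : K * K = (2 : ℂ) • P := by
      simp [hP, hK, mul_add, add_mul, sub_mul, mul_sub, hij, hij.symm, two_smul]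
      abel
    have hs : star (1 - P + (c : ℂ) • K) = 1 - P + (c : ℂ) • K := by
      simp [hP, hK, star_eq_conjTranspose, conjTranspose_single]
      abel_nf
    rw [hs]
    calc (1 - P + (c : ℂ) • K) * (1 - P + (c : ℂ) • K)
        = 1 - P - P + P * P + (c : ℂ) • (K - P * K) + (c : ℂ) • (K - K * P)
          + ((c : ℂ) * c) • (K * K) := by
          simp only [add_mul, mul_add, sub_mul, mul_sub, smul_mul_assoc, mul_smul_comm, smul_sub,
            smul_add, smul_smul, one_mul, mul_one]
          abel
      _ = 1 := by
          rw [hPP, hPK, hKP, hKK, hc, smul_smul]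
          simp⟩

theorem mul_hadamardU_left {n : ℕ} {i j : Fin n} (hij : i ≠ j) (U : UGroup n) (r : Fin n) :
    (U * hadamardU i j hij).1 r i = (((√2)⁻¹ : ℝ) : ℂ) * (U.1 r i + U.1 r j) := by
  simp [hadamardU, mul_add, mul_sub, hij]

theorem mul_hadamardU_right {n : ℕ} {i j : Fin n} (hij : i ≠ j) (U : UGroup n) (r : Fin n) :
    (U * hadamardU i j hij).1 r j = (((√2)⁻¹ : ℝ) : ℂ) * (U.1 r i - U.1 r j) := by
  simp [hadamardU, mul_add, mul_sub, hij.symm]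

theorem mul_hadamardU_of_ne {n : ℕ} {i j k : Fin n} (hij : i ≠ j) (hi : k ≠ i) (hj : k ≠ j)
    (U : UGroup n) (r : Fin n) : (U * hadamardU i j hij).1 r k = U.1 r k := by
  simp [hadamardU, mul_add, mul_sub, hi, hj]

/-- The Hadamard rotation turns |x|²|y|² into |x² - y²|²/4. Its cross terms integrate to zero, and
the two quartic terms are equal by symmetry. -/
theorem integral_entrySq_sq_mul {n : ℕ} {i j : Fin n} (hij : i ≠ j) (r : Fin n)
    {S : Finset (Fin n)} (hi : i ∉ S) (hj : j ∉ S) :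
    ∫ U, entrySq U r i ^ 2 * ∏ k ∈ S, entrySq U r k ∂(haarU n) =
      2 * ∫ U, entrySq U r i * entrySq U r j * ∏ k ∈ S, entrySq U r k ∂(haarU n) := by
  have hc : (((√2)⁻¹ : ℝ) : ℂ) * (((√2)⁻¹ : ℝ) : ℂ) = 2⁻¹ := by
    rw [← Complex.ofReal_mul, ← mul_inv, Real.mul_self_sqrt zero_le_two]; simp
  have hD (i : Fin n) : Integrable
      (fun U : UGroup n => entrySq U r i ^ 2 * ∏ k ∈ S, entrySq U r k) (haarU n) :=
    integrable_haarU (((continuous_entrySq r i).pow 2).mul (continuous_prod_entrySq r S))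
  have hC (i j : Fin n) : Integrable (fun U : UGroup n =>
      U.1 r i ^ 2 * star (U.1 r j) ^ 2 * ∏ k ∈ S, entrySq U r k) (haarU n) :=
    integrable_haarU ((((continuous_entry r i).pow 2).mul ((continuous_entry r j).star.pow 2)).mul
      (continuous_prod_entrySq r S))
  have key : ∫ U, entrySq U r i * entrySq U r j * ∏ k ∈ S, entrySq U r k ∂(haarU n) =
      ∫ U : UGroup n, 4⁻¹ * (entrySq U r i ^ 2 * ∏ k ∈ S, entrySq U r k +
        entrySq U r j ^ 2 * ∏ k ∈ S, entrySq U r k -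
        (U.1 r i ^ 2 * star (U.1 r j) ^ 2 * ∏ k ∈ S, entrySq U r k +
          U.1 r j ^ 2 * star (U.1 r i) ^ 2 * ∏ k ∈ S, entrySq U r k)) ∂(haarU n) := by
    rw [← integral_haarU_mul_right _ (hadamardU i j hij)]
    congr 1 with U
    have hS : ∏ k ∈ S, entrySq (U * hadamardU i j hij) r k = ∏ k ∈ S, entrySq U r k := by
      refine Finset.prod_congr rfl fun k hk => ?_
      rw [entrySq, entrySq, mul_hadamardU_of_ne hij] <;> rintro rfl <;> contradiction
    rw [hS]
    simp only [entrySq, mul_hadamardU_left, mul_hadamardU_right, star_mul', star_add, star_sub]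
    have hcs : star (((√2)⁻¹ : ℝ) : ℂ) = (((√2)⁻¹ : ℝ) : ℂ) := Complex.conj_ofReal _
    rw [hcs]
    generalize (((√2)⁻¹ : ℝ) : ℂ) = c at hc
    generalize ∏ k ∈ S, U.1 r k * star (U.1 r k) = w
    generalize star (U.1 r i) = x'
    generalize star (U.1 r j) = y'
    generalize U.1 r i = x
    generalize U.1 r j = y
    -- This is c⁴ - 1/4 = (c² + 1/2)(c² - 1/2).
    linear_combination (x + y) * (x' + y') * (x - y) * (x' - y') * w * (c * c + 2⁻¹) * hc
  have hDD : Integrable (fun U : UGroup n => entrySq U r i ^ 2 * ∏ k ∈ S, entrySq U r k +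
      entrySq U r j ^ 2 * ∏ k ∈ S, entrySq U r k) (haarU n) := (hD i).add (hD j)
  have hCC : Integrable (fun U : UGroup n =>
      U.1 r i ^ 2 * star (U.1 r j) ^ 2 * ∏ k ∈ S, entrySq U r k +
        U.1 r j ^ 2 * star (U.1 r i) ^ 2 * ∏ k ∈ S, entrySq U r k) (haarU n) :=
    (hC i j).add (hC j i)
  rw [key, integral_const_mul, integral_sub hDD hCC,
    integral_add (hD i) (hD j), integral_add (hC i j) (hC j i),
    integral_cross_entry_eq_zero hij, integral_cross_entry_eq_zero hij.symm,
    integral_entrySq_sq_mul_eq r hj hi]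
  ring

/-- Insert 1 = Σ |u_ri|²: each i outside `S` contributes the right-hand integral once, each i in `S`
twice, and (n - |S|) + 2|S| = n + |S|. -/
theorem integral_prod_entrySq_eq_mul {n : ℕ} {j : Fin n} (r : Fin n) {S : Finset (Fin n)}
    (hj : j ∉ S) :
    ∫ U, ∏ k ∈ S, entrySq U r k ∂(haarU n) =
      (n + S.card) * ∫ U, ∏ k ∈ insert j S, entrySq U r k ∂(haarU n) := by
  set c := ∫ U, ∏ k ∈ insert j S, entrySq U r k ∂(haarU n) with hc
  have h1 : ∫ U, ∏ k ∈ S, entrySq U r k ∂(haarU n) =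
      ∑ i, ∫ U, entrySq U r i * ∏ k ∈ S, entrySq U r k ∂(haarU n) := by
    have hint (i : Fin n) : Integrable (fun U : UGroup n =>
        entrySq U r i * ∏ k ∈ S, entrySq U r k) (haarU n) :=
      integrable_haarU ((continuous_entrySq r i).mul (continuous_prod_entrySq r S))
    rw [← integral_finsetSum _ fun i _ => hint i]
    congr 1 with U
    rw [← Finset.sum_mul, sum_entrySq, one_mul]
  have h2 (i : Fin n) : ∫ U, entrySq U r i * ∏ k ∈ S, entrySq U r k ∂(haarU n) =
      c + if i ∈ S then c else 0 := by
    split_ifs with hi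
    · have hij : i ≠ j := by rintro rfl; contradiction
      have hj' : j ∉ S.erase i := fun h => hj (Finset.mem_of_mem_erase h)
      have h := integral_entrySq_sq_mul hij r (Finset.notMem_erase i S) hj'
      rw [← two_mul, hc]
      convert h using 3 with U U
      · rw [← Finset.mul_prod_erase S _ hi]; ring
      · ext U
        rw [Finset.prod_insert hj, ← Finset.mul_prod_erase S _ hi]; ring
    · rw [add_zero, hc, integral_prod_insert_entrySq_eq r hj hi]
      simp only [Finset.prod_insert hi]
  rw [h1, Finset.sum_congr rfl fun i _ => h2 i, Finset.sum_add_distrib, Finset.sum_ite_mem]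
  simp
  ring

/-- The moments of distinct squared moduli in a row of a Haar unitary matrix. -/
theorem integral_prod_entrySq {n : ℕ} (r : Fin n) (S : Finset (Fin n)) :
    ∫ U, ∏ k ∈ S, entrySq U r k ∂(haarU n) = 1 / (n.ascFactorial S.card : ℂ) := by
  induction S using Finset.induction_on with
  | empty => simp
  | insert j S hj ih =>
    have hn : (n : ℂ) + S.card ≠ 0 := by
      have : 0 < n := r.pos
      exact_mod_cast (by omega : n + S.card ≠ 0)
    rw [integral_prod_entrySq_eq_mul r hj] at ih
    rw [Finset.card_insert_of_notMem hj, Nat.ascFactorial_succ, eq_div_of_mul_eq hn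
      ((mul_comm _ _).trans ih), div_div]
    push_cast
    rw [mul_comm]

/-! ### The recursion: Gram matrix and expansion -/

/-- The first `m` rows of a unitary matrix, with columns selected by `c`. -/
def upperBlock {m : ℕ} (U : UGroup (m + 1)) (c : Fin m → Fin (m + 1)) : Matrix (Fin m) (Fin m) ℂ :=
  Matrix.of fun i a => U.1 i.castSucc (c a)

/-- Orthonormality of the columns of `U`, with the last row's term moved to the other side. -/
theorem conjTranspose_upperBlock_mul {m : ℕ} (U : UGroup (m + 1)) (c d : Fin m → Fin (m + 1))
    (a b : Fin m) :
    ((upperBlock U c)ᴴ * upperBlock U d) b a =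
      (if c b = d a then 1 else 0) - star (U.1 (Fin.last m) (c b)) * U.1 (Fin.last m) (d a) := by
  have hU : U.1ᴴ * U.1 = 1 := mem_unitaryGroup_iff'.1 U.2
  have h := congrFun (congrFun hU (c b)) (d a)
  rw [Matrix.mul_apply, Fin.sum_univ_castSucc, Matrix.one_apply] at h
  rw [← h]
  simp [Matrix.mul_apply, upperBlock]

theorem integral_blockU {m : ℕ} (π : Equiv.Perm (Fin (m + 1))) (U : UGroup (m + 1)) :
    ∫ V, (∏ i, (blockU V * U).1 i i) * star (∏ i, (blockU V * U).1 i (π i)) ∂(haarU m) =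
      U.1 (Fin.last m) (Fin.last m) * star (U.1 (Fin.last m) (π (Fin.last m))) *
        diagPairing (upperBlock U Fin.castSucc) (upperBlock U fun a => π a.castSucc) := by
  rw [diagPairing, ← integral_const_mul]
  congr 1 with V
  rw [Fin.prod_univ_castSucc, Fin.prod_univ_castSucc, blockU_mul_last, blockU_mul_last, star_mul']
  simp only [blockU_mul_castSucc, Matrix.mul_apply, upperBlock, Matrix.of_apply]
  ring

/-- The product arising from the Gram matrix of the first `m` rows, for each permutation `τ`. -/
noncomputable def gramProd {m : ℕ} (π : Equiv.Perm (Fin (m + 1))) (τ : Equiv.Perm (Fin m))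
    (U : UGroup (m + 1)) : ℂ :=
  U.1 (Fin.last m) (Fin.last m) * star (U.1 (Fin.last m) (π (Fin.last m))) *
    ∏ b : Fin m, ((if π (τ b).castSucc = b.castSucc then 1 else 0) -
      U.1 (Fin.last m) b.castSucc * star (U.1 (Fin.last m) (π (τ b).castSucc)))

theorem continuous_gramProd {m : ℕ} (π : Equiv.Perm (Fin (m + 1))) (τ : Equiv.Perm (Fin m)) :
    Continuous (gramProd π τ) := by
  unfold gramProd
  refine ((continuous_entry _ _).mul (continuous_entry _ _).star).mul
    (continuous_finsetProd _ fun b _ => continuous_const.sub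
      ((continuous_entry _ _).mul (continuous_entry _ _).star))

theorem Wg_succ_eq_sum {m : ℕ} (π : Equiv.Perm (Fin (m + 1))) :
    Wg (m + 1) (m + 1) le_rfl π =
      ∑ τ : Equiv.Perm (Fin m), (∫ U, gramProd π τ U ∂(haarU (m + 1))) * Wg m m le_rfl τ := by
  have hc (f : Fin (m + 1) → Fin (m + 1)) :
      Continuous fun U : UGroup (m + 1) => ∏ a, U.1 a (f a) :=
    continuous_finsetProd _ fun a _ => continuous_entry _ _
  have h := integral_haarU_succ
    (f := fun U : UGroup (m + 1) => (∏ i, U.1 i i) * star (∏ i, U.1 i (π i)))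
    ((hc id).mul (hc π).star)
  simp only [integral_blockU] at h
  refine h.trans ?_
  have hint (τ : Equiv.Perm (Fin m)) : Integrable
      (fun U : UGroup (m + 1) => gramProd π τ U * Wg m m le_rfl τ) (haarU (m + 1)) :=
    integrable_haarU ((continuous_gramProd π τ).mul continuous_const)
  simp only [← integral_mul_const]
  rw [← integral_finsetSum _ fun τ _ => hint τ]
  congr 1 with U
  -- Summing over inverses puts `τ` on the side of `π`, as in `gramProd`; `Wg_inv` absorbs the
  -- change.
  rw [diagPairing_eq_sum_Wg, Finset.mul_sum, ← Equiv.sum_comp (Equiv.inv (Equiv.Perm (Fin m)))]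
  refine Finset.sum_congr rfl fun τ _ => ?_
  rw [Equiv.inv_apply, Wg_inv, ← mul_assoc, gramProd]
  congr 2
  rw [star_prod, ← Equiv.prod_comp τ]
  refine Finset.prod_congr rfl fun b _ => ?_
  rw [conjTranspose_upperBlock_mul, ← Equiv.Perm.mul_apply, inv_mul_cancel, Equiv.Perm.one_apply,
    star_sub, star_mul', star_star]
  simp [eq_comm, apply_ite]

/-- A permutation supported in `S` may be removed from the product of `f i * star (f (σ i))` over
`S`. -/
theorem prod_mul_star_eq_prod_sq {n : ℕ} (f : Fin n → ℂ) (σ : Equiv.Perm (Fin n))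
    (S : Finset (Fin n)) (hS : ∀ i ∉ S, σ i = i) :
    ∏ i ∈ S, f i * star (f (σ i)) = ∏ i ∈ S, f i * star (f i) := by
  rw [Finset.prod_mul_distrib, Finset.prod_mul_distrib]
  congr 1
  refine Equiv.Perm.prod_comp σ S (fun i => star (f i)) fun i hi => ?_
  by_contra h
  exact hi (hS i h)

/-- The coefficients of the recursion are the moments of `gramProd`. -/
theorem integral_gramProd {m : ℕ} (π : Equiv.Perm (Fin (m + 1))) (τ : Equiv.Perm (Fin m)) :
    ∫ U, gramProd π τ U ∂(haarU (m + 1)) = aCoeff m π τ := by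
  set F := Finset.univ.filter fun i : Fin m => π (τ i).castSucc = i.castSucc with hF
  -- σ is π composed with the extension of τ fixing the last index.
  obtain ⟨σ, hσ, hσl⟩ : ∃ σ : Equiv.Perm (Fin (m + 1)),
      (∀ b : Fin m, σ b.castSucc = π (τ b).castSucc) ∧ σ (Fin.last m) = π (Fin.last m) :=
    ⟨((finSuccEquivLast.trans τ.optionCongr).trans finSuccEquivLast.symm).trans π,
      fun b => by simp, by simp⟩
  have hexp (U : UGroup (m + 1)) : gramProd π τ U = ∑ T ∈ F.powerset,
      (-1 : ℂ) ^ (m + 1 - T.card + 1) *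
        ∏ k ∈ (T.map Fin.castSuccEmb)ᶜ, entrySq U (Fin.last m) k := by
    have hadd := Finset.prod_add
      (fun b : Fin m => if π (τ b).castSucc = b.castSucc then (1 : ℂ) else 0)
      (fun b => -(U.1 (Fin.last m) b.castSucc * star (U.1 (Fin.last m) (π (τ b).castSucc))))
      Finset.univ
    simp only [← sub_eq_add_neg] at hadd
    rw [gramProd, hadd, Finset.mul_sum]
    refine (Finset.sum_subset (Finset.powerset_mono.2 (Finset.subset_univ F)) ?_).symm.trans ?_
    · intro T _ hT
      rw [Finset.prod_ite_zero, if_neg, zero_mul, mul_zero]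
      intro h
      exact hT (Finset.mem_powerset.2 fun i hi => by simpa [hF] using h i hi)
    · refine Finset.sum_congr rfl fun T hT => ?_
      have hTF : ∀ i ∈ T, π (τ i).castSucc = i.castSucc := fun i hi => by
        simpa [hF] using Finset.mem_powerset.1 hT hi
      have hTm : T.card ≤ m := by simpa using T.card_le_univ
      have hcompl : (T.map Fin.castSuccEmb)ᶜ =
          insert (Fin.last m) ((Finset.univ \ T).map Fin.castSuccEmb) := by
        ext k
        refine Fin.lastCases ?_ (fun k => ?_) k <;> simp [Fin.castSucc_ne_last]
      -- σ fixes the image of `T` pointwise, so it permutes the complement and the product there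
      -- collapses to squared moduli.
      have hfix := prod_mul_star_eq_prod_sq (fun k => U.1 (Fin.last m) k) σ
        (T.map Fin.castSuccEmb)ᶜ (fun k hk => by
          obtain ⟨i, hi, rfl⟩ := Finset.mem_map.1 (Finset.notMem_compl.1 hk)
          exact (hσ i).trans (hTF i hi))
      have hsign : (-1 : ℂ) ^ (m + 1 - T.card + 1) = (-1) ^ (m - T.card) := by
        rw [show m + 1 - T.card + 1 = m - T.card + 2 by omega, pow_add]
        simp
      unfold entrySq
      rw [← hfix, hcompl, Finset.prod_insert (by simp [Fin.castSucc_ne_last]), Finset.prod_map,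
        hσl, hsign, Finset.prod_neg, Finset.prod_ite_zero, if_pos hTF, Finset.prod_const_one,
        Finset.card_sdiff_of_subset (Finset.subset_univ T), Finset.card_univ, Fintype.card_fin]
      simp only [Fin.castSuccEmb_apply, hσ]
      ring
  simp only [hexp]
  rw [integral_finsetSum]
  · simp only [integral_const_mul, integral_prod_entrySq]
    have hcard (T : Finset (Fin m)) : ((T.map Fin.castSuccEmb)ᶜ).card = m + 1 - T.card := by
      rw [Finset.card_compl, Finset.card_map, Fintype.card_fin]
    simp only [hcard]
    rw [Finset.sum_powerset_apply_card (fun t => (-1 : ℂ) ^ (m + 1 - t + 1) *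
      (1 / ((Nat.ascFactorial (m + 1) (m + 1 - t) : ℕ) : ℂ))), aCoeff]
    refine Finset.sum_congr rfl fun t _ => ?_
    rw [nsmul_eq_mul, fixCount]
    ring
  · exact fun T _ => integrable_haarU (continuous_const.mul (continuous_prod_entrySq _ _))

/-- The recursion in dimension `n = m + 1`, for every `n ≥ 1`. -/
theorem theorem3p8 (m : ℕ) (π : Equiv.Perm (Fin (m + 1))) :
    Wg (m + 1) (m + 1) le_rfl π =
      ∑ τ : Equiv.Perm (Fin m), aCoeff m π τ * Wg m m le_rfl τ := by
  simp only [Wg_succ_eq_sum, integral_gramProd]
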